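/- Let $A$ be a unital locally $C^*$-algebra, that is, a unital complex $*$-algebra with a separating family $\{P_\alpha\}_{\alpha\in\Delta}$ of seminorms satisfying $P_\alpha(ab)\le P_\alpha(a)P_\alpha(b)$, $P_\alpha(a^*)=P_\alpha(a)$ and $P_\alpha(a^*a)=P_\alpha(a)^2$ for all $a,b\in A$ and $\alpha\in\Delta$, which is complete in the locally convex topology they define. An element of $A$ is positive if it is of the form $b^*b$ with $b\in A$. Let $X$ be a Hilbert $A$-module, that is, a right $A$-module (whose complex vector space structure is compatible with that of $A$) with a map $\langle\cdot,\cdot\rangle: X\times X\to A$ such that $\langle x,x\rangle\ge 0$, $\langle x,x\rangle=0$ if and only if $x=0$, $\langle x_1+x_2,y\rangle=\langle x_1,y\rangle+\langle x_2,y\rangle$, $\langle xa,y\rangle=\langle x,y\rangle a$ and $\langle x,y\rangle^*=\langle y,x\rangle$ for all $x,x_1,x_2,y\in X$ and $a\in A$, and which is complete with respect to the seminorms $\bar P_\alpha(x)=P_\alpha(\langle x,x\rangle)^{1/2}$, $\alpha\in\Delta$. Let $\mathrm{End}_A(X)$ be the set of bounded operators on $X$, i.e. of $\mathbb C$-linear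 maps $T:X\to X$ with $T(xa)=(Tx)a$ for all $x\in X$, $a\in A$, such that for each $\alpha\in\Delta$ there is a constant $C_\alpha>0$ with $\bar P_\alpha(Tx)\le C_\alpha\bar P_\alpha(x)$ for all $x\in X$. Let $\mathrm{End}^*_A(X)$ be the set of those $T\in\mathrm{End}_A(X)$ for which there is $S\in\mathrm{End}_A(X)$ with $\langle Tx,y\rangle=\langle x,Sy\rangle$ for all $x,y\in X$. Let $T:X\to X$ and $T^*:X\to X$ be arbitrary maps such that $\langle x,Ty\rangle=\langle T^*x,y\rangle$ for all $x,y\in X$. Then $T$ and $T^*$ are bounded operators on $X$, i.e. $T,T^*\in\mathrm{End}_A(X)$, and consequently $T\in\mathrm{End}^*_A(X)$. -/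

import Mathlib

open scoped RightActions

/-- Completeness of an additive group with respect to a family of (semi)norm-like functions `p α`,
that is, of the uniform structure given by the `p α (x - y)`: every Cauchy filter converges. -/
def IsCompleteFor {Δ E : Type*} [AddCommGroup E] (p : Δ → E → ℝ) : Prop :=
  ∀ F : Filter E, F.NeBot →
    (∀ α : Δ, ∀ ε : ℝ, 0 < ε → ∃ s ∈ F, ∀ x ∈ s, ∀ y ∈ s, p α (x - y) < ε) →
    ∃ z : E, ∀ α : Δ, ∀ ε : ℝ, 0 < ε → ∀ᶠ x in F, p α (x - z) < ε

/-- The unital complex `*`-algebra `A` is a locally `C*`-algebra with respect to the family `P`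
of `C*`-seminorms: `P` is separating (the topology is Hausdorff) and `A` is complete. -/
structure IsLocallyCStarAlgebra {Δ A : Type*} [Ring A] [StarRing A] [Algebra ℂ A]
    [StarModule ℂ A] (P : Δ → Seminorm ℂ A) : Prop where
  separating : ∀ a : A, (∀ α, P α a = 0) → a = 0
  mul_le : ∀ α (a b : A), P α (a * b) ≤ P α a * P α b
  star_eq : ∀ α (a : A), P α (star a) = P α a
  star_mul_self : ∀ α (a : A), P α (star a * a) = P α a ^ 2
  complete : IsCompleteFor fun α (a : A) => P α a

/-- Positive elements of a locally `C*`-algebra: Hermitian elements of the form `b* b`. -/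
def IsPositiveElem {A : Type*} [Ring A] [StarRing A] (a : A) : Prop :=
  IsSelfAdjoint a ∧ ∃ b : A, a = star b * b

/-- `A`-valued inner products on the right `A`-module `X` (linear in the first variable). -/
structure IsAInnerProduct {A X : Type*} [Ring A] [StarRing A] [AddCommGroup X] [Module Aᵐᵒᵖ X]
    (ip : X → X → A) : Prop where
  nonneg : ∀ x, IsPositiveElem (ip x x)
  eq_zero_iff : ∀ x, ip x x = 0 ↔ x = 0
  add_left : ∀ x₁ x₂ y, ip (x₁ + x₂) y = ip x₁ y + ip x₂ y
  smul_left : ∀ x y (a : A), ip (x <• a) y = ip x y * a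
  star_eq : ∀ x y, star (ip x y) = ip y x

/-- The functions `x ↦ P α (⟨x, x⟩) ^ (1/2)` on a pre-Hilbert `A`-module. -/
noncomputable def barP {Δ A X : Type*} [Ring A] [Algebra ℂ A]
    (P : Δ → Seminorm ℂ A) (ip : X → X → A) (α : Δ) (x : X) : ℝ :=
  Real.sqrt (P α (ip x x))

/-- `X` with the inner product `ip` is a Hilbert `A`-module. -/
structure IsHilbertAModule {Δ A X : Type*} [Ring A] [StarRing A] [Algebra ℂ A]
    [AddCommGroup X] [Module Aᵐᵒᵖ X]
    (P : Δ → Seminorm ℂ A) (ip : X → X → A) : Prop where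
  innerProduct : IsAInnerProduct ip
  complete : IsCompleteFor (barP P ip)

/-- `End_A(X)`: the bounded operators on `X`, i.e. the `ℂ`-linear `A`-homomorphisms that are
bounded with respect to each `barP P ip α`. -/
def EndA {Δ A X : Type*} [Ring A] [Algebra ℂ A] [AddCommGroup X] [Module ℂ X]
    [Module Aᵐᵒᵖ X] (P : Δ → Seminorm ℂ A) (ip : X → X → A) : Set (X → X) :=
  {T | IsLinearMap ℂ T ∧ (∀ (x : X) (a : A), T (x <• a) = T x <• a) ∧
    ∀ α, ∃ C : ℝ, 0 < C ∧ ∀ x, barP P ip α (T x) ≤ C * barP P ip α x}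

/-- `End*_A(X)`: the bounded operators that have an adjoint among the bounded operators. -/
def EndStarA {Δ A X : Type*} [Ring A] [Algebra ℂ A] [AddCommGroup X] [Module ℂ X]
    [Module Aᵐᵒᵖ X] (P : Δ → Seminorm ℂ A) (ip : X → X → A) : Set (X → X) :=
  {T | T ∈ EndA P ip ∧ ∃ S ∈ EndA P ip, ∀ x y, ip (T x) y = ip x (S y)}

-- Linearity and `A`-linearity of `T` follow from nondegeneracy of the inner product; boundedness is
-- the real content. As `Δ` may be uncountable, `X` need not be a Fréchet space, so a Banach space
-- inside it is used.
--
-- Elements of `X` on which all seminorms are jointly bounded form a Banach space under the supremum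
-- norm. The adjoint relation makes `x ↦ barP P ip α (T x)` lower semicontinuous there, even for the
-- single seminorm `barP P ip α`, so uniform boundedness gives `barP P ip α (T x) ≤ C * K` whenever
-- every seminorm of `x` is at most `K` (`exists_bound_of_isCompleteFor`).
--
-- To make the right side depend on `α` alone, truncate: with `c = (1 + ⟨x, x⟩)⁻¹`, all seminorms of
-- `xc` are at most `2`, while `1 - c` is small for `P α` if `x` is (`exists_smul_barP_le`). Then
-- `Tx = T(xc) + (Tx)(1 - c)`, and the last term is absorbed on the left. Scaling finishes the
-- proof.

universe u

/-! ### The C*-algebra attached to one C*-seminorm -/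

section Completion

open UniformSpace

theorem uniformContinuous_star_of_normedStarGroup {A : Type*} [SeminormedAddCommGroup A]
    [StarAddMonoid A] [NormedStarGroup A] : UniformContinuous (star : A → A) :=
  (AddMonoidHomClass.isometry_of_norm (starAddEquiv (R := A)) norm_star).uniformContinuous

/-- The involution on the completion of a seminormed `*`-ring. -/
noncomputable abbrev completionStarRing (A : Type*) [SeminormedRing A] [StarRing A]
    [NormedStarGroup A] : StarRing (Completion A) :=
  have hu : UniformContinuous (star : A → A) := uniformContinuous_star_of_normedStarGroup
  have hc : Continuous (Completion.map (star : A → A)) := Completion.continuous_map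
  { star := Completion.map star
    star_involutive := fun x => by
      induction x using Completion.induction_on with
      | hp => exact isClosed_eq (by fun_prop) (by fun_prop)
      | ih x => simp only [Completion.map_coe hu, star_star]
    star_mul := fun x y => by
      change Completion.map star (x * y) = Completion.map star y * Completion.map star x
      induction x, y using Completion.induction_on₂ with
      | hp => exact isClosed_eq (by fun_prop) (by fun_prop)
      | ih x y => simp only [← Completion.coe_mul, Completion.map_coe hu, star_mul]
    star_add := fun x y => by
      change Completion.map star (x + y) = Completion.map star x + Completion.map star y
      induction x, y using Completion.induction_on₂ with
      | hp => exact isClosed_eq (by fun_prop) (by fun_prop)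
      | ih x y => simp only [← Completion.coe_add, Completion.map_coe hu, star_add] }

/-- The completion of a `*`-algebra with a `C*`-seminorm is a `C*`-algebra. -/
noncomputable abbrev completionCStarAlgebra (A : Type*) [SeminormedRing A] [StarRing A]
    [NormedStarGroup A] [NormedAlgebra ℂ A] [StarModule ℂ A]
    (h : ∀ a : A, ‖star a * a‖ = ‖a‖ ^ 2) : CStarAlgebra (Completion A) :=
  letI := completionStarRing A
  have hu : UniformContinuous (star : A → A) := uniformContinuous_star_of_normedStarGroup
  have hc : Continuous (star : Completion A → Completion A) := Completion.continuous_map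
  have hs : ∀ a : A, star (a : Completion A) = (star a : A) := Completion.map_coe hu
  have hsmul : ∀ (r : ℂ) (x : Completion A), star (r • x) = star r • star x := fun r x => by
    induction x using Completion.induction_on with
    | hp =>
      exact isClosed_eq (hc.comp (continuous_const_smul r))
        ((continuous_const_smul (star r)).comp hc)
    | ih x => rw [hs, ← Completion.coe_smul, ← Completion.coe_smul, hs, star_smul]
  { norm_mul_self_le := fun x => by
      induction x using Completion.induction_on with
      | hp => exact isClosed_le (by fun_prop) (by fun_prop)
      | ih x => rw [hs, ← Completion.coe_mul, Completion.norm_coe, Completion.norm_coe, h, sq]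
    norm_smul_le := norm_smul_le
    star_smul := hsmul }

/-- Transfers order and norm facts from C*-algebras to a single seminorm. No quotient by the kernel
is taken: the Hausdorff completion already identifies points at distance zero. -/
theorem exists_starAlgHom_norm_eq {A : Type u} [Ring A] [StarRing A] [Algebra ℂ A]
    [StarModule ℂ A] (p : Seminorm ℂ A) (mul_le : ∀ a b, p (a * b) ≤ p a * p b)
    (star_eq : ∀ a, p (star a) = p a) (star_mul_self : ∀ a, p (star a * a) = p a ^ 2) :
    ∃ (B : Type u) (_ : CStarAlgebra B) (φ : A →⋆ₐ[ℂ] B), ∀ a, ‖φ a‖ = p a := by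
  let _ : SeminormedAddCommGroup A := p.toAddGroupSeminorm.toSeminormedAddCommGroup
  let _ : SeminormedRing A :=
    { ‹Ring A›, ‹SeminormedAddCommGroup A› with norm_mul_le := mul_le }
  let _ : NormedAlgebra ℂ A := { norm_smul_le := fun r x => (map_smul_eq_mul p r x).le }
  let _ : NormedStarGroup A := ⟨fun a => (star_eq a).le⟩
  let _ : CStarAlgebra (Completion A) := completionCStarAlgebra A star_mul_self
  refine ⟨Completion A, inferInstance,
    { toFun := fun a => (a : Completion A)
      map_one' := rfl
      map_mul' := Completion.coe_mul
      map_zero' := rfl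
      map_add' := Completion.coe_add
      commutes' := fun r => rfl
      map_star' := fun a =>
        (Completion.map_coe uniformContinuous_star_of_normedStarGroup a).symm },
    fun a => Completion.norm_coe a⟩

end Completion

/-! ### Order inequalities for one C*-seminorm -/

section CStarSeminorm

variable {A : Type*} [Ring A] [StarRing A] [Algebra ℂ A]

/-- Submultiplicative, `*`-invariant seminorms satisfying the `C*`-identity. -/
structure IsCStarSeminorm (p : Seminorm ℂ A) : Prop where
  mul_le : ∀ a b, p (a * b) ≤ p a * p b
  star_eq : ∀ a, p (star a) = p a
  star_mul_self : ∀ a, p (star a * a) = p a ^ 2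

theorem IsLocallyCStarAlgebra.isCStarSeminorm [StarModule ℂ A] {Δ : Type*} {P : Δ → Seminorm ℂ A}
    (hA : IsLocallyCStarAlgebra P) (α : Δ) : IsCStarSeminorm (P α) :=
  ⟨hA.mul_le α, hA.star_eq α, hA.star_mul_self α⟩

variable {p : Seminorm ℂ A}

theorem IsCStarSeminorm.map_one_le (hp : IsCStarSeminorm p) : p 1 ≤ 1 := by
  have h := hp.star_mul_self 1
  rw [star_one, one_mul] at h
  nlinarith [apply_nonneg p 1]

/-- In the C*-algebra image, `0 ≤ a ≤ r` gives `0 ≤ r - a ≤ r`. -/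
theorem IsCStarSeminorm.map_smul_one_sub_le [StarModule ℂ A] (hp : IsCStarSeminorm p) {a : A}
    (ha : IsPositiveElem a) {r : ℝ} (hr : p a ≤ r) : p ((r : ℂ) • 1 - a) ≤ r := by
  obtain ⟨B, _, φ, hφ⟩ :=
    exists_starAlgHom_norm_eq p hp.mul_le hp.star_eq hp.star_mul_self
  let _ := CStarAlgebra.spectralOrder B
  have _ := CStarAlgebra.spectralOrderedRing B
  have hr0 : 0 ≤ r := (apply_nonneg p a).trans hr
  obtain ⟨-, b, rfl⟩ := ha
  have h0 : 0 ≤ φ (star b * b) := by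
    rw [map_mul, map_star]; exact star_mul_self_nonneg _
  have hle : φ (star b * b) ≤ algebraMap ℝ B r :=
    (CStarAlgebra.norm_le_iff_le_algebraMap _ hr0 h0).1 (by rwa [hφ])
  rw [← hφ, map_sub, map_smul, map_one]
  have e : (r : ℂ) • (1 : B) = algebraMap ℝ B r := by
    rw [Algebra.algebraMap_eq_smul_one]; exact Complex.coe_smul r (1 : B)
  rw [e, CStarAlgebra.norm_le_iff_le_algebraMap _ hr0 (sub_nonneg.2 hle)]
  exact sub_le_self _ h0

/-- The order-theoretic core of the Cauchy–Schwarz inequality. -/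
theorem IsCStarSeminorm.sq_le_mul_of_isPositiveElem [StarModule ℂ A] (hp : IsCStarSeminorm p)
    {u v g : A} (hu : IsPositiveElem u)
    (h : ∀ t : ℝ, IsPositiveElem
      (((t ^ 2 : ℝ) : ℂ) • (star g * u * g) - ((2 * t : ℝ) : ℂ) • (star g * g) + v)) :
    p g ^ 2 ≤ p u * p v := by
  obtain ⟨B, _, φ, hφ⟩ :=
    exists_starAlgHom_norm_eq p hp.mul_le hp.star_eq hp.star_mul_self
  let _ := CStarAlgebra.spectralOrder B
  have _ := CStarAlgebra.spectralOrderedRing B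
  -- Since `g* u g ≤ ‖u‖ g* g`, the hypothesis gives `(2t - ts) g* g ≤ v`; then take norms. The
  -- extra parameter `s` also covers `p u = 0`, where `t` can be arbitrarily large.
  have key : ∀ s t : ℝ, 0 ≤ t → t * p u ≤ s → (2 * t - t * s) * p g ^ 2 ≤ p v := by
    intro s t ht hs
    by_cases h2 : 2 * t - t * s ≤ 0
    · exact (mul_nonpos_of_nonpos_of_nonneg h2 (sq_nonneg _)).trans (apply_nonneg p v)
    push Not at h2
    obtain ⟨-, b, hb⟩ := h t
    have h0 : 0 ≤ φ (star b * b) := by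
      rw [map_mul, map_star]; exact star_mul_self_nonneg _
    rw [← hb] at h0
    simp only [map_add, map_sub, map_smul, map_mul, map_star] at h0
    simp only [Complex.coe_smul] at h0
    have hsa : IsSelfAdjoint (φ u) := by
      rw [IsSelfAdjoint, ← map_star, hu.1.star_eq]
    have h1 := CStarAlgebra.star_left_conjugate_le_norm_smul (a := φ g) (b := φ u) hsa
    rw [hφ] at h1
    have hg : 0 ≤ star (φ g) * φ g := star_mul_self_nonneg _
    have h3 : (2 * t - t * s) • (star (φ g) * φ g) ≤ φ v := by
      have h4 : (t ^ 2) • (star (φ g) * φ u * φ g) ≤ (t * s) • (star (φ g) * φ g) :=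
        (smul_le_smul_of_nonneg_left h1 (sq_nonneg t)).trans (by
          rw [smul_smul]
          exact smul_le_smul_of_nonneg_right (by nlinarith) hg)
      rw [sub_smul, sub_le_iff_le_add]
      have h5 : (2 * t) • (star (φ g) * φ g) ≤
          (t ^ 2) • (star (φ g) * φ u * φ g) + φ v := by
        rw [← sub_nonneg]
        convert h0 using 1
        abel
      exact h5.trans (by rw [add_comm]; gcongr)
    have h6 := CStarAlgebra.norm_le_norm_of_nonneg_of_le (smul_nonneg h2.le hg) h3
    rw [norm_smul, CStarRing.norm_star_mul_self, hφ, hφ, Real.norm_of_nonneg h2.le, ← sq] at h6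
    exact h6
  have hu0 := apply_nonneg p u
  have hv0 := apply_nonneg p v
  rcases hu0.eq_or_lt with h0 | h0
  · rw [← h0, zero_mul]
    by_contra! hg
    have := key 0 ((p v + 1) / p g ^ 2) (by positivity) (by rw [← h0]; simp)
    rw [mul_zero, sub_zero, mul_assoc, div_mul_cancel₀ _ hg.ne'] at this
    linarith
  · have := key 1 (1 / p u) (by positivity) (by field_simp; exact le_rfl)
    field_simp at this
    linarith

end CStarSeminorm

/-! ### The inverse of `1 + a` for positive `a` -/

section Resolvent

variable {A : Type*} [Ring A] [StarRing A] [Algebra ℂ A]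

theorem IsCStarSeminorm.map_pow_le {p : Seminorm ℂ A} (hp : IsCStarSeminorm p) {a : A} {r : ℝ}
    (h : p a ≤ r) (k : ℕ) : p (a ^ k) ≤ r ^ k := by
  induction k with
  | zero => simpa using hp.map_one_le
  | succ k ih =>
    rw [pow_succ, pow_succ]
    exact (hp.mul_le _ _).trans
      (mul_le_mul ih h (apply_nonneg p a) ((apply_nonneg p _).trans ih))

/-- Polynomial approximations of the inverse of `1 + a`, good for all `C*`-seminorms that are
at most `n` at the positive element `a`. -/
theorem exists_approx_inverse_one_add [StarModule ℂ A] {a : A} (ha : IsPositiveElem a)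
    (n : ℕ) :
    ∃ d e : A, (1 + a) * d = 1 - e ∧ d * (1 + a) = 1 - e ∧
      ∀ p : Seminorm ℂ A, IsCStarSeminorm p → p a ≤ n → p d ≤ 1 ∧ p e ≤ 1 / ((n : ℝ) + 1) := by
  have hn : (0 : ℝ) < (n : ℝ) + 1 := by positivity
  have hnC : ((n : ℂ) + 1) ≠ 0 := by exact_mod_cast hn.ne'
  set ρ : ℝ := n / ((n : ℝ) + 1) with hρ
  have hρ0 : 0 ≤ ρ := by positivity
  have hρ1 : ρ < 1 := by rw [hρ, div_lt_one hn]; linarith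
  -- The length `m` depends on `n` only, so the same `d` and `e` serve all seminorms: `d` is a
  -- Neumann series for `(n + 1)(1 - h)` truncated at `m`, and `e = h ^ m` is its remainder.
  obtain ⟨m, hm⟩ := exists_pow_lt_of_lt_one (show 0 < 1 / ((n : ℝ) + 1) by positivity) hρ1
  set h : A := ((n : ℂ) + 1)⁻¹ • (((n : ℝ) : ℂ) • 1 - a) with hh
  have h1 : 1 + a = ((n : ℂ) + 1) • (1 - h) := by
    rw [hh, smul_sub, smul_inv_smul₀ hnC, add_smul, one_smul, Complex.ofReal_natCast]
    abel
  refine ⟨((n : ℂ) + 1)⁻¹ • ∑ i ∈ Finset.range m, h ^ i, h ^ m, ?_, ?_, fun p hp hpa => ?_⟩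
  · rw [h1, smul_mul_smul_comm, mul_inv_cancel₀ hnC, one_smul, mul_neg_geom_sum]
  · rw [h1, smul_mul_smul_comm, inv_mul_cancel₀ hnC, one_smul, geom_sum_mul_neg]
  have hnorm : ‖((n : ℂ) + 1)⁻¹‖ = ((n : ℝ) + 1)⁻¹ := by
    rw [norm_inv]
    congr 1
    exact_mod_cast Complex.norm_of_nonneg hn.le
  have hph : p h ≤ ρ := by
    rw [hh, map_smul_eq_mul, hnorm, hρ, div_eq_inv_mul]
    exact mul_le_mul_of_nonneg_left (hp.map_smul_one_sub_le ha hpa) (by positivity)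
  refine ⟨?_, (hp.map_pow_le hph m).trans hm.le⟩
  rw [map_smul_eq_mul, hnorm]
  have hs : p (∑ i ∈ Finset.range m, h ^ i) ≤ (n : ℝ) + 1 :=
    calc p (∑ i ∈ Finset.range m, h ^ i) ≤ ∑ i ∈ Finset.range m, p (h ^ i) :=
          Finset.le_sum_of_subadditive p (map_zero p).le (map_add_le_add p) _ _
      _ ≤ ∑ i ∈ Finset.range m, ρ ^ i := Finset.sum_le_sum fun i _ => hp.map_pow_le hph i
      _ ≤ (1 - ρ)⁻¹ := by
          rw [← one_div, le_div_iff₀ (sub_pos.2 hρ1), geom_sum_mul_neg]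
          linarith [pow_nonneg hρ0 m]
      _ = (n : ℝ) + 1 := by rw [hρ]; field_simp; ring
  calc ((n : ℝ) + 1)⁻¹ * _ ≤ ((n : ℝ) + 1)⁻¹ * ((n : ℝ) + 1) := by gcongr
    _ = 1 := inv_mul_cancel₀ hn.ne'

/-- For a positive element `a` of a locally `C*`-algebra, `1 + a` has a contractive inverse. -/
theorem IsLocallyCStarAlgebra.exists_inverse_one_add [StarModule ℂ A] {Δ : Type*}
    {P : Δ → Seminorm ℂ A} (hA : IsLocallyCStarAlgebra P) {a : A} (ha : IsPositiveElem a) :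
    ∃ c : A, (1 + a) * c = 1 ∧ ∀ α, P α c ≤ 1 := by
  choose d e hde hed hP using exists_approx_inverse_one_add ha
  have hev : ∀ α, ∀ ε : ℝ, 0 < ε → ∃ N : ℕ, ∀ n ≥ N, P α (d n) ≤ 1 ∧ P α (e n) < ε := by
    intro α ε hε
    obtain ⟨N₁, hN₁⟩ := exists_nat_ge (P α a)
    obtain ⟨N₂, hN₂⟩ := exists_nat_one_div_lt hε
    refine ⟨max N₁ N₂, fun n hn => ?_⟩
    have h := hP n (P α) (hA.isCStarSeminorm α)
      (hN₁.trans (by exact_mod_cast (le_max_left _ _).trans hn))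
    refine ⟨h.1, h.2.trans_lt (lt_of_le_of_lt ?_ hN₂)⟩
    have : (N₂ : ℝ) ≤ n := by exact_mod_cast (le_max_right _ _).trans hn
    gcongr
  -- Evaluate `d n * (1 + a) * d k` in two ways.
  have hdiff : ∀ n k, d n - d k = d n * e k - e n * d k := by
    intro n k
    have h : d n * (1 - e k) = (1 - e n) * d k := by rw [← hde, ← hed, mul_assoc]
    rw [mul_sub, sub_mul, mul_one, one_mul] at h
    calc d n - d k = (d n - d n * e k) - (d k - e n * d k) + (d n * e k - e n * d k) := by abel
      _ = d n * e k - e n * d k := by rw [h, sub_self, zero_add]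
  obtain ⟨c, hc⟩ := hA.complete (Filter.map d Filter.atTop) inferInstance (by
    intro α ε hε
    obtain ⟨N, hN⟩ := hev α (ε / 2) (half_pos hε)
    refine ⟨d '' Set.Ici N, Filter.image_mem_map (Filter.mem_atTop N), ?_⟩
    rintro _ ⟨n, hn, rfl⟩ _ ⟨k, hk, rfl⟩
    change P α (d n - d k) < ε
    rw [hdiff]
    obtain ⟨hn1, hn2⟩ := hN n hn
    obtain ⟨hk1, hk2⟩ := hN k hk
    have h1 := (hA.mul_le α (d n) (e k)).trans
      (mul_le_mul_of_nonneg_right hn1 (apply_nonneg _ _))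
    have h2 := (hA.mul_le α (e n) (d k)).trans
      (mul_le_mul_of_nonneg_left hk1 (apply_nonneg _ _))
    linarith [map_sub_le_add (P α) (d n * e k) (e n * d k)])
  have hlim : ∀ α, ∀ ε : ℝ, 0 < ε → ∃ n, P α (d n) ≤ 1 ∧ P α (e n) < ε ∧ P α (d n - c) < ε := by
    intro α ε hε
    obtain ⟨N, hN⟩ := hev α ε hε
    obtain ⟨n, h1, h2⟩ :=
      ((Filter.eventually_ge_atTop N).and (Filter.eventually_map.1 (hc α ε hε))).exists
    exact ⟨n, (hN n h1).1, (hN n h1).2, h2⟩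
  refine ⟨c, ?_, fun α => ?_⟩
  · rw [← sub_eq_zero]
    refine hA.separating _ fun α => le_antisymm (le_of_forall_pos_le_add fun ε hε => ?_)
      (apply_nonneg _ _)
    have hK : 0 < P α (1 + a) + 1 := by have := apply_nonneg (P α) (1 + a); linarith
    obtain ⟨n, -, h2, h3⟩ := hlim α (ε / (P α (1 + a) + 1)) (by positivity)
    have e1 : (1 + a) * c - 1 = -((1 + a) * (d n - c)) - e n := by
      rw [mul_sub, hde]; abel
    rw [e1]
    have h4 := map_sub_le_add (P α) (-((1 + a) * (d n - c))) (e n)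
    rw [map_neg_eq_map] at h4
    have h5 := hA.mul_le α (1 + a) (d n - c)
    have h6 : P α (1 + a) * P α (d n - c) ≤ P α (1 + a) * (ε / (P α (1 + a) + 1)) := by gcongr
    have h7 : P α (1 + a) * (ε / (P α (1 + a) + 1)) + ε / (P α (1 + a) + 1) = ε := by
      field_simp
    linarith
  · refine le_of_forall_pos_le_add fun ε hε => ?_
    obtain ⟨n, h1, -, h3⟩ := hlim α ε hε
    have h4 := map_sub_le_add (P α) (d n) (d n - c)
    rw [sub_sub_cancel] at h4
    linarith

end Resolvent

/-! ### Uniform boundedness on the jointly bounded elements -/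

section UniformBoundedness

variable {Δ E : Type*} [AddCommGroup E] [Module ℂ E]

/-- The elements on which a family of seminorms is bounded. -/
def boundedSubmodule (q : Δ → Seminorm ℂ E) : Submodule ℂ E where
  carrier := {x | BddAbove (Set.range fun β => q β x)}
  zero_mem' := ⟨0, by rintro _ ⟨β, rfl⟩; simp⟩
  add_mem' := by
    rintro x y ⟨K, hK⟩ ⟨L, hL⟩
    refine ⟨K + L, ?_⟩
    rintro _ ⟨β, rfl⟩
    exact (map_add_le_add (q β) x y).trans (add_le_add (hK ⟨β, rfl⟩) (hL ⟨β, rfl⟩))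
  smul_mem' := by
    rintro c x ⟨K, hK⟩
    refine ⟨‖c‖ * K, ?_⟩
    rintro _ ⟨β, rfl⟩
    change q β (c • x) ≤ _
    rw [map_smul_eq_mul]
    exact mul_le_mul_of_nonneg_left (hK ⟨β, rfl⟩) (norm_nonneg c)

/-- A seminorm that is lower semicontinuous with respect to one member of a separating and complete
family of seminorms is bounded by a multiple of the supremum of the family. -/
theorem exists_bound_of_isCompleteFor (q : Δ → Seminorm ℂ E)
    (sep : ∀ x, (∀ β, q β x = 0) → x = 0) (hq : IsCompleteFor fun β x => q β x)
    (p : Seminorm ℂ E) (α : Δ)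
    (hp : ∀ x r, (∀ ε : ℝ, 0 < ε → ∃ y, q α (y - x) < ε ∧ p y ≤ r) → p x ≤ r) :
    ∃ C : ℝ, 0 < C ∧ ∀ x K, (∀ β, q β x ≤ K) → p x ≤ C * K := by
  have : Nonempty Δ := ⟨α⟩
  let S := boundedSubmodule q
  have hS : ∀ x : S, BddAbove (Set.range fun β => q β x) := fun x => x.2
  let _ : Norm S := ⟨fun x => ⨆ β, q β x⟩
  have hle : ∀ (x : S) β, q β x ≤ ‖x‖ := fun x β => le_ciSup (hS x) β
  have hnorm : ∀ (x : S) K, (∀ β, q β x ≤ K) → ‖x‖ ≤ K := fun x K h => ciSup_le h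
  have hcore : NormedSpace.Core ℂ S :=
    { norm_nonneg := fun x => (apply_nonneg (q α) _).trans (hle x α)
      norm_smul := fun c x => by
        change ⨆ β, q β (c • (x : E)) = ‖c‖ * ⨆ β, q β (x : E)
        simp only [map_smul_eq_mul]
        exact (Real.mul_iSup_of_nonneg (norm_nonneg c) _).symm
      norm_triangle := fun x y => hnorm _ _ fun β =>
        (map_add_le_add (q β) (x : E) y).trans (add_le_add (hle x β) (hle y β))
      norm_eq_zero_iff := fun x => by
        constructor
        · intro h
          exact Subtype.ext (sep _ fun β => le_antisymm ((hle x β).trans h.le) (apply_nonneg _ _))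
        · rintro rfl
          change ⨆ β, q β ((0 : S) : E) = 0
          simp }
  let _ : NormedAddCommGroup S := NormedAddCommGroup.ofCore hcore
  let _ : NormedSpace ℂ S := NormedSpace.ofCore hcore
  have : CompleteSpace S := by
    refine Metric.complete_of_cauchySeq_tendsto fun u hu => ?_
    rw [Metric.cauchySeq_iff] at hu
    have hu' : ∀ ε > 0, ∃ N, ∀ m ≥ N, ∀ n ≥ N, ∀ β, q β ((u m : E) - u n) < ε := by
      intro ε hε
      obtain ⟨N, hN⟩ := hu ε hε
      refine ⟨N, fun m hm n hn β => ?_⟩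
      have := hN m hm n hn
      rw [dist_eq_norm] at this
      exact (hle (u m - u n) β).trans_lt this
    obtain ⟨z, hz⟩ := hq (Filter.map (fun n => (u n : E)) Filter.atTop) inferInstance (by
      intro β ε hε
      obtain ⟨N, hN⟩ := hu' ε hε
      refine ⟨(fun n => (u n : E)) '' Set.Ici N, Filter.image_mem_map (Filter.mem_atTop N), ?_⟩
      rintro _ ⟨m, hm, rfl⟩ _ ⟨n, hn, rfl⟩
      exact hN m hm n hn β)
    -- Completeness of `E` gives convergence for each `β` separately; the Cauchy bound, uniform in
    -- `β`, passes to the limit.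
    have hlim : ∀ ε > 0, ∃ N, ∀ n ≥ N, ∀ β, q β ((u n : E) - z) ≤ ε := by
      intro ε hε
      obtain ⟨N, hN⟩ := hu' ε hε
      refine ⟨N, fun n hn β => le_of_forall_pos_le_add fun δ hδ => ?_⟩
      obtain ⟨k, h1, h2⟩ :=
        ((Filter.eventually_ge_atTop N).and (Filter.eventually_map.1 (hz β δ hδ))).exists
      have h3 := map_add_le_add (q β) ((u n : E) - u k) (u k - z)
      rw [sub_add_sub_cancel] at h3
      exact h3.trans (add_le_add (hN n hn k h1 β).le (le_of_lt h2))
    have hzS : z ∈ S := by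
      obtain ⟨N, hN⟩ := hlim 1 one_pos
      have h : (u N : E) - z ∈ S := ⟨1, by rintro _ ⟨β, rfl⟩; exact hN N le_rfl β⟩
      simpa using S.sub_mem (u N).2 h
    refine ⟨⟨z, hzS⟩, Metric.tendsto_atTop.2 fun ε hε => ?_⟩
    obtain ⟨N, hN⟩ := hlim (ε / 2) (half_pos hε)
    refine ⟨N, fun n hn => ?_⟩
    rw [dist_eq_norm]
    exact (hnorm _ _ fun β => hN n hn β).trans_lt (half_lt_self hε)
  -- Sublevel sets are closed because the norm of `S` dominates `q α`. On the barrelled space `S`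
  -- this forces continuity.
  have hlsc : LowerSemicontinuous (p.comp S.subtype) := by
    refine lowerSemicontinuous_iff_isClosed_preimage.2 fun r => ?_
    refine isClosed_of_closure_subset fun x hx => hp x r fun ε hε => ?_
    obtain ⟨y, hy, hxy⟩ := Metric.mem_closure_iff.1 hx ε hε
    refine ⟨y, ?_, hy⟩
    rw [dist_comm, dist_eq_norm] at hxy
    exact (hle (y - x) α).trans_lt hxy
  obtain ⟨C, hC, hbound⟩ := Seminorm.bound_of_continuous_normedSpace (p.comp S.subtype)
    (Seminorm.continuous_of_lowerSemicontinuous _ hlsc)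
  refine ⟨C, hC, fun x K hK => ?_⟩
  have hxS : x ∈ S := ⟨K, by rintro _ ⟨β, rfl⟩; exact hK β⟩
  exact (hbound ⟨x, hxS⟩).trans (mul_le_mul_of_nonneg_left (hnorm ⟨x, hxS⟩ K hK) hC.le)

end UniformBoundedness

/-! ### Algebra of the inner product -/

section InnerProduct

variable {A X : Type*} [Ring A] [StarRing A] [AddCommGroup X] [Module Aᵐᵒᵖ X] {ip : X → X → A}

namespace IsAInnerProduct

theorem add_right (h : IsAInnerProduct ip) (x y z : X) : ip x (y + z) = ip x y + ip x z := by
  rw [← h.star_eq, h.add_left, star_add, h.star_eq, h.star_eq]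

theorem smul_right (h : IsAInnerProduct ip) (x y : X) (a : A) :
    ip x (y <• a) = star a * ip x y := by
  rw [← h.star_eq, h.smul_left, star_mul, h.star_eq]

theorem sub_left (h : IsAInnerProduct ip) (x y z : X) : ip (x - y) z = ip x z - ip y z := by
  rw [eq_sub_iff_add_eq, ← h.add_left, sub_add_cancel]

theorem sub_right (h : IsAInnerProduct ip) (x y z : X) : ip x (y - z) = ip x y - ip x z := by
  rw [eq_sub_iff_add_eq, ← h.add_right, sub_add_cancel]

theorem ext_left (h : IsAInnerProduct ip) {y z : X} (hyz : ∀ x, ip x y = ip x z) : y = z := by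
  rw [← sub_eq_zero, ← h.eq_zero_iff, h.sub_right, hyz, sub_self]

/-- Makes the roles of `T` and its adjoint symmetric, so one boundedness proof serves both. -/
theorem adjoint_symm (h : IsAInnerProduct ip) {T S : X → X}
    (hT : ∀ x y, ip x (T y) = ip (S x) y) (x y : X) : ip x (S y) = ip (T x) y := by
  rw [← h.star_eq, ← hT, h.star_eq]

variable [Algebra ℂ A] [Module ℂ X] [IsScalarTower ℂ Aᵐᵒᵖ X]

theorem complex_smul_left (h : IsAInnerProduct ip) (c : ℂ) (x y : X) :
    ip (c • x) y = c • ip x y := by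
  have hc : c • x = x <• (c • (1 : A)) := by
    rw [MulOpposite.op_smul, smul_assoc, MulOpposite.op_one, one_smul]
  rw [hc, h.smul_left, mul_smul_comm, mul_one]

theorem complex_smul_right [StarModule ℂ A] (h : IsAInnerProduct ip) (c : ℂ) (x y : X) :
    ip x (c • y) = star c • ip x y := by
  rw [← h.star_eq, h.complex_smul_left, star_smul, h.star_eq]

end IsAInnerProduct

end InnerProduct

/-! ### Seminorms on `X` and boundedness of adjointable maps -/

section BarSeminorm

section

variable {Δ A X : Type*} [Ring A] [Algebra ℂ A] {P : Δ → Seminorm ℂ A} {ip : X → X → A}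

theorem barP_nonneg (α : Δ) (x : X) : 0 ≤ barP P ip α x :=
  Real.sqrt_nonneg _

theorem barP_sq (α : Δ) (x : X) : barP P ip α x ^ 2 = P α (ip x x) :=
  Real.sq_sqrt (apply_nonneg _ _)

end

variable {Δ A X : Type*} [Ring A] [StarRing A] [Algebra ℂ A] [StarModule ℂ A]
  [AddCommGroup X] [Module Aᵐᵒᵖ X] {P : Δ → Seminorm ℂ A} {ip : X → X → A}

theorem map_inner_le_barP_mul_barP (hA : IsLocallyCStarAlgebra P) (h : IsAInnerProduct ip) (α : Δ)
    (x y : X) : P α (ip x y) ≤ barP P ip α x * barP P ip α y := by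
  rw [← abs_of_nonneg (apply_nonneg (P α) (ip x y)),
    ← abs_of_nonneg (mul_nonneg (barP_nonneg (P := P) (ip := ip) α x) (barP_nonneg α y)),
    ← sq_le_sq, mul_pow, barP_sq, barP_sq, ← hA.star_eq]
  refine (hA.isCStarSeminorm α).sq_le_mul_of_isPositiveElem (h.nonneg x) fun t => ?_
  -- Expand `⟨xa - y, xa - y⟩` with `a = t⟨x, y⟩*`.
  convert h.nonneg ((x <• ((t : ℂ) • star (ip x y))) - y) using 1
  have ht : star (t : ℂ) = t := Complex.conj_ofReal t
  rw [h.sub_left, h.sub_right, h.sub_right, h.smul_left, h.smul_left, h.smul_right, h.smul_right,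
    star_smul, star_star, ht, h.star_eq]
  simp only [smul_mul_assoc, mul_smul_comm, smul_smul, mul_assoc, two_mul,
    Complex.ofReal_add, Complex.ofReal_mul, add_smul, sq]
  abel

theorem barP_smul_le (hA : IsLocallyCStarAlgebra P) (h : IsAInnerProduct ip) (α : Δ)
    (x : X) (a : A) : barP P ip α (x <• a) ≤ barP P ip α x * P α a := by
  refine Real.sqrt_le_iff.2 ⟨mul_nonneg (barP_nonneg α x) (apply_nonneg _ _), ?_⟩
  rw [mul_pow, barP_sq, h.smul_left, h.smul_right]
  refine (hA.mul_le α _ _).trans ?_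
  have h1 := hA.mul_le α (star a) (ip x x)
  rw [hA.star_eq] at h1
  nlinarith [apply_nonneg (P α) a]

/-- Truncation: an element that is small for one seminorm is close, up to multiplication by an
element of `A` near `1`, to one that is bounded for all of them. -/
theorem exists_smul_barP_le (hA : IsLocallyCStarAlgebra P) (h : IsAInnerProduct ip) (x : X) :
    ∃ c : A, (∀ β, barP P ip β (x <• c) ≤ 2) ∧ ∀ α, P α (1 - c) ≤ barP P ip α x ^ 2 := by
  obtain ⟨c, hc, hc1⟩ := hA.exists_inverse_one_add (h.nonneg x)
  have hac : ip x x * c = 1 - c := by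
    rw [eq_sub_iff_add_eq, ← hc, add_mul, one_mul, add_comm]
  refine ⟨c, fun β => ?_, fun α => ?_⟩
  · refine Real.sqrt_le_iff.2 ⟨zero_le_two, ?_⟩
    -- `⟨xc, xc⟩ = c*(1 - c)` has seminorm at most `1 * 2 ≤ 2 ^ 2`.
    rw [h.smul_left, h.smul_right, mul_assoc, hac]
    have h1 := hA.mul_le β (star c) (1 - c)
    rw [hA.star_eq] at h1
    have h2 := map_sub_le_add (P β) 1 c
    have h3 := (hA.isCStarSeminorm β).map_one_le
    have h4 := hc1 β
    have h5 := apply_nonneg (P β) c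
    have h6 := apply_nonneg (P β) (1 - c)
    nlinarith
  · rw [← hac, barP_sq]
    exact (hA.mul_le α _ _).trans
      (mul_le_of_le_one_right (apply_nonneg _ _) (hc1 α))

variable [Module ℂ X] [IsScalarTower ℂ Aᵐᵒᵖ X]

/-- The functions `barP P ip α` as seminorms. -/
noncomputable def barSeminorm (hA : IsLocallyCStarAlgebra P) (h : IsAInnerProduct ip) (α : Δ) :
    Seminorm ℂ X :=
  Seminorm.of (barP P ip α)
    (fun x y => by
      refine Real.sqrt_le_iff.2 ⟨add_nonneg (barP_nonneg α x) (barP_nonneg α y), ?_⟩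
      rw [h.add_left, h.add_right, h.add_right]
      have h1 := map_add_le_add (P α) (ip x x + ip x y) (ip y x + ip y y)
      have h2 := map_add_le_add (P α) (ip x x) (ip x y)
      have h3 := map_add_le_add (P α) (ip y x) (ip y y)
      have h4 := map_inner_le_barP_mul_barP hA h α x y
      have h5 := map_inner_le_barP_mul_barP hA h α y x
      have h6 := barP_sq (P := P) (ip := ip) α x
      have h7 := barP_sq (P := P) (ip := ip) α y
      nlinarith)
    (fun c x => by
      rw [barP, h.complex_smul_left, h.complex_smul_right, smul_smul, map_smul_eq_mul, norm_mul,
        norm_star, Real.sqrt_mul (by positivity), Real.sqrt_mul_self (norm_nonneg c), barP])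

/-- A map on a Hilbert module that has an adjoint is a bounded operator. -/
theorem mem_EndA_of_adjoint (hA : IsLocallyCStarAlgebra P) (hX : IsHilbertAModule P ip)
    {T S : X → X} (hT : ∀ x y, ip x (T y) = ip (S x) y) : T ∈ EndA P ip := by
  have h := hX.innerProduct
  have hS := h.adjoint_symm hT
  have hlin : IsLinearMap ℂ T :=
    ⟨fun y z => h.ext_left fun x => by simp only [hT, h.add_right],
      fun c y => h.ext_left fun x => by simp only [hT, h.complex_smul_right]⟩
  have hmod : ∀ (x : X) (a : A), T (x <• a) = T x <• a := fun y a =>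
    h.ext_left fun x => by simp only [hT, h.smul_right]
  refine ⟨hlin, hmod, fun α => ?_⟩
  let q : Δ → Seminorm ℂ X := barSeminorm hA h
  have sep : ∀ x, (∀ β, q β x = 0) → x = 0 := fun x hx =>
    (h.eq_zero_iff x).1 (hA.separating _ fun β => by
      rw [← barP_sq, show barP P ip β x = 0 from hx β, zero_pow two_ne_zero])
  let p : Seminorm ℂ X := (q α).comp hlin.mk'
  obtain ⟨C, hC, hbound⟩ := exists_bound_of_isCompleteFor q sep hX.complete p α (by
    intro x r hr
    change barP P ip α (T x) ≤ r
    set M := barP P ip α (S (T x))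
    have hM : 0 ≤ M := barP_nonneg α _
    have hTx : 0 ≤ barP P ip α (T x) := barP_nonneg α _
    have hr0 : 0 ≤ r := by
      obtain ⟨y, -, hy⟩ := hr 1 one_pos
      exact (apply_nonneg p y).trans hy
    -- Only the finite value `M` at the single vector `S (T x)` enters, so continuity of `S` is not
    -- needed.
    have hsq : barP P ip α (T x) ^ 2 ≤ r * barP P ip α (T x) := by
      refine le_of_forall_pos_le_add fun ε hε => ?_
      obtain ⟨y, hy1, hy2⟩ := hr (ε / (M + 1)) (by positivity)
      change barP P ip α (y - x) < _ at hy1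
      change barP P ip α (T y) ≤ r at hy2
      have e : ip (T x) (T x) = ip (T y) (T x) - ip (y - x) (S (T x)) := by
        rw [hS, hlin.map_sub, h.sub_left, sub_sub_cancel]
      rw [barP_sq, e]
      have h1 := map_sub_le_add (P α) (ip (T y) (T x)) (ip (y - x) (S (T x)))
      have h2 := (map_inner_le_barP_mul_barP hA h α (T y) (T x)).trans
        (mul_le_mul_of_nonneg_right hy2 hTx)
      have h3 := (map_inner_le_barP_mul_barP hA h α (y - x) (S (T x))).trans
        (mul_le_mul_of_nonneg_right hy1.le hM)
      have h4 : ε / (M + 1) * M ≤ ε := by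
        rw [div_mul_eq_mul_div, div_le_iff₀ (by positivity)]
        nlinarith
      linarith
    by_contra! hlt
    nlinarith)
  have hsmall : ∀ x, barP P ip α x ≤ 1 / 2 → barP P ip α (T x) ≤ 4 * C := by
    intro x hx
    obtain ⟨c, hc1, hc2⟩ := exists_smul_barP_le hA h x
    have h1 : barP P ip α (T (x <• c)) ≤ C * 2 := hbound _ _ hc1
    have h2 : barP P ip α (T x) ≤
        barP P ip α (T (x <• c)) + barP P ip α (T x <• (1 - c)) := by
      have h3 := map_add_le_add (q α) (T (x <• c)) (T x <• (1 - c))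
      rw [hmod, ← add_smul, ← MulOpposite.op_add, add_sub_cancel, MulOpposite.op_one,
        one_smul, ← hmod] at h3
      exact h3
    have h4 := barP_smul_le hA h α (T x) (1 - c)
    have h5 : P α (1 - c) ≤ 1 / 4 := by
      have := barP_nonneg (P := P) (ip := ip) α x
      exact (hc2 α).trans (by nlinarith)
    have h6 := mul_le_mul_of_nonneg_left h5 (barP_nonneg (P := P) (ip := ip) α (T x))
    linarith
  refine ⟨8 * C, by positivity, fun x => ?_⟩
  refine le_of_forall_pos_le_add fun ε hε => ?_
  have hx : 0 ≤ barP P ip α x := barP_nonneg α x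
  -- The added term keeps `s` positive when `barP P ip α x = 0`.
  set s := barP P ip α x + ε / (8 * C) with hs
  have hs0 : 0 < s := by positivity
  have hnorm : ‖(((2 * s)⁻¹ : ℝ) : ℂ)‖ = (2 * s)⁻¹ :=
    Complex.norm_of_nonneg (by positivity)
  have h1 : barP P ip α ((((2 * s)⁻¹ : ℝ) : ℂ) • x) = (2 * s)⁻¹ * barP P ip α x := by
    exact (map_smul_eq_mul (q α) _ x).trans (by rw [hnorm]; rfl)
  have h2 : barP P ip α (T ((((2 * s)⁻¹ : ℝ) : ℂ) • x)) = (2 * s)⁻¹ * barP P ip α (T x) := by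
    rw [hlin.map_smul]; exact (map_smul_eq_mul (q α) _ (T x)).trans (by rw [hnorm]; rfl)
  have hxs : barP P ip α x ≤ s := by rw [hs]; linarith [show 0 < ε / (8 * C) by positivity]
  have h3 := hsmall ((((2 * s)⁻¹ : ℝ) : ℂ) • x) (by
    rw [h1, inv_mul_le_iff₀ (by positivity)]; linarith)
  rw [h2, inv_mul_le_iff₀ (by positivity)] at h3
  have h4 : 8 * C * s = 8 * C * barP P ip α x + ε := by
    rw [hs]; field_simp
  linarith

end BarSeminorm

theorem lemma3p2 {Δ A X : Type*} [Ring A] [StarRing A] [Algebra ℂ A] [StarModule ℂ A]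
    [AddCommGroup X] [Module ℂ X] [Module Aᵐᵒᵖ X] [IsScalarTower ℂ Aᵐᵒᵖ X]
    (P : Δ → Seminorm ℂ A) (hA : IsLocallyCStarAlgebra P)
    (ip : X → X → A) (hX : IsHilbertAModule P ip)
    (T Tstar : X → X) (hT : ∀ x y : X, ip x (T y) = ip (Tstar x) y) :
    T ∈ EndA P ip ∧ Tstar ∈ EndA P ip ∧ T ∈ EndStarA P ip := by
  have hS := hX.innerProduct.adjoint_symm hT
  have hT' := mem_EndA_of_adjoint hA hX hT
  have hS' := mem_EndA_of_adjoint hA hX hS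
  exact ⟨hT', hS', hT', Tstar, hS', fun x y => (hS x y).symm⟩
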